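/- Let $B>1$, put $\kappa=\frac{\sqrt B+1}{\sqrt B-1}$, and for $n\ge 1$ let $x_k=\frac{B-1}{2}\cos\frac{(2k+1)\pi}{2(n+1)}+\frac{B+1}{2}$, $k=0,\dots,n$, be the $n+1$ Chebyshev nodes on $[1,B]$. Let $f:[0,B]\to\mathbb R$ be real-analytic and suppose that, for some $C>0$ and $0<M<1$, $$|f^{(k)}(x)|\le C\,M^k\qquad\text{for all }k\ge 0\text{ and all }x\in[1,B].$$ For $m\le n$ let $p_m$ be the least-squares fit of $f$ at these nodes, that is, the polynomial of degree at most $m$ which minimizes $\sum_{k=0}^n (p(x_k)-f(x_k))^2$. Suppose that $\kappa\le M^{-\mu m/(2n)}$ for some $\mu\in(0,1)$, and put $$C'=\frac{2(B-1)CM}{\pi}\Bigl(\frac1{1-M\kappa^2}+\frac1{1-M}\Bigr).$$ Then $|p_m(0)-f(0)|<\varepsilon$ provided that $$m=\Omega\!\left(\frac{\log(C'/\varepsilon)}{(1-\mu)\log(1/M)}\right),$$ in both of the following senses. 1. (Every $\varepsilon>0$.) There is a constant $K>0$, depending only on $B$, such that for all $M,C,f,n,m,\mu$ as above and every $\varepsilon>0$,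 $$m\ \ge\ K\,\frac{\max\{1,\log(C'/\varepsilon)\}}{(1-\mu)\log(1/M)}\quad\Longrightarrow\quad |p_m(0)-f(0)|<\varepsilon .$$ 2. (As $\varepsilon\to0$, with an arbitrary implied constant.) For every $K>0$ and every $M\in(0,1)$ there is $r>0$, depending only on $K$, $B$ and $M$, such that for all $C,f,n,m,\mu$ as above and every $0<\varepsilon\le r\,C'$, $$m\ \ge\ K\,\frac{\log(C'/\varepsilon)}{(1-\mu)\log(1/M)}\quad\Longrightarrow\quad |p_m(0)-f(0)|<\varepsilon .$$ -/

import Mathlib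

open Set Polynomial

noncomputable section

/-- The `k`-th of the `n + 1` Chebyshev nodes of the first kind on `[1, B]`: the image of
`cos ((2k+1)π / (2(n+1)))`, `k = 0, …, n`, under the affine bijection `[-1, 1] → [1, B]`. -/
def chebNode (B : ℝ) (n k : ℕ) : ℝ :=
  (B - 1) / 2 * Real.cos ((2 * (k : ℝ) + 1) * Real.pi / (2 * ((n : ℝ) + 1))) + (B + 1) / 2

/-- The sum of squared residuals of the polynomial `p` for the data `f` at the `n + 1` Chebyshev
nodes on `[1, B]`. -/
def sqResidual (f : ℝ → ℝ) (B : ℝ) (n : ℕ) (p : ℝ[X]) : ℝ :=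
  ∑ k ∈ Finset.range (n + 1), (p.eval (chebNode B n k) - f (chebNode B n k)) ^ 2

/-- `p` is a least-squares fit of `f`, at the `n + 1` Chebyshev nodes on `[1, B]`, among the
polynomials of degree at most `m`. -/
def IsLeastSquaresFit (f : ℝ → ℝ) (B : ℝ) (n m : ℕ) (p : ℝ[X]) : Prop :=
  p.natDegree ≤ m ∧ ∀ q : ℝ[X], q.natDegree ≤ m → sqResidual f B n p ≤ sqResidual f B n q

/-- The Gevrey-type bound `|f⁽ᵏ⁾(x)| ≤ C Mᵏ` for all `k ≥ 0` and all `x ∈ [1, B]`. The function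
lives on `[0, B]`, and its derivatives are taken there (one-sided at the end point `B`). -/
def GevreyBound (f : ℝ → ℝ) (B C M : ℝ) : Prop :=
  ∀ k : ℕ, ∀ x ∈ Icc (1 : ℝ) B, |iteratedDerivWithin k f (Icc (0 : ℝ) B) x| ≤ C * M ^ k

/-- `κ = (√B + 1) / (√B - 1)`. -/
def kappa (B : ℝ) : ℝ := (Real.sqrt B + 1) / (Real.sqrt B - 1)

/-- `C' = (2 (B - 1) C M / π) (1 / (1 - M κ²) + 1 / (1 - M))`. -/
def biasConst (B C M : ℝ) : ℝ :=
  2 * (B - 1) * C * M / Real.pi * (1 / (1 - M * kappa B ^ 2) + 1 / (1 - M))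

end

/-! The bound `C * M ^ k` makes the Taylor coefficients of `f` at the midpoint decay like `M ^ k /
k!`, so the truncation `q` of degree `m` errs by at most `E = O(C (MB)^(m+1) / m!)` on all of `[0,
B]`, including at `0`. By minimality, `p - q` has root mean square at most `2E` over the nodes.
Discrete orthogonality then bounds its Chebyshev coefficients, and `T_j` grows at most like `κ ^ j`
at the point corresponding to `0`. Hence the error at `0` is at most `A C' (Mκ)^m B^m / m!`, with
`A` depending only on `B`.

The hypothesis on `κ` gives `Mκ ≤ M^(1-μ)`. For the first claim this geometric decay suffices, with
`B^m / m! ≤ exp B`. For the second, `K` may be too small for it, so `(Mκ)^m` is merely bounded by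
`1` and the factorial beats every exponential once `m` is large. -/

/-- A function analytic on `[0, B]` whose derivatives on `[1, B]` grow at most geometrically is the
sum of its Taylor series at the midpoint of `[1, B]`, on the whole of `[0, B]`. -/
theorem GevreyBound.exists_hasSum {f : ℝ → ℝ} {B C M : ℝ} (hB : 1 < B)
    (hf : AnalyticOn ℝ f (Icc 0 B)) (h : GevreyBound f B C M) :
    ∃ b : ℕ → ℝ, (∀ k, |b k| ≤ C * M ^ k / k.factorial) ∧
      ∀ x ∈ Icc (0 : ℝ) B, HasSum (fun k ↦ b k * (x - (B + 1) / 2) ^ k) (f x) := by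
  set c := (B + 1) / 2 with hc
  have hcm : c ∈ Ioo (0 : ℝ) B := by constructor <;> linarith
  have hfo : AnalyticOnNhd ℝ f (Ioo 0 B) :=
    isOpen_Ioo.analyticOn_iff_analyticOnNhd.mp (hf.mono Ioo_subset_Icc_self)
  set b : ℕ → ℝ := fun k ↦ iteratedDeriv k f c / k.factorial with hb
  have hbk (k : ℕ) : |b k| ≤ C * M ^ k / k.factorial := by
    have hd := h k c ⟨by linarith, by linarith⟩
    rw [iteratedDerivWithin_eq_iteratedDeriv (uniqueDiffOn_Icc (by linarith))
      ((hfo c hcm).contDiffAt) (Ioo_subset_Icc_self hcm)] at hd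
    rw [hb, abs_div, Nat.abs_cast]
    gcongr
  refine ⟨b, hbk, ?_⟩
  set p := FormalMultilinearSeries.ofScalars ℝ b with hp
  have hrad : p.radius = ⊤ := by
    refine FormalMultilinearSeries.radius_eq_top_of_summable_norm _ fun r ↦ ?_
    refine Summable.of_nonneg_of_le (fun _ ↦ by positivity) (fun k ↦ ?_)
      ((Real.summable_pow_div_factorial (M * r)).mul_left C)
    rw [hp, FormalMultilinearSeries.ofScalars_norm, Real.norm_eq_abs]
    calc |b k| * (r : ℝ) ^ k ≤ C * M ^ k / k.factorial * r ^ k := by gcongr; exact hbk k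
      _ = _ := by rw [mul_pow]; ring
  set g : ℝ → ℝ := fun t ↦ p.sum (t - c) with hg
  have hgs : HasFPowerSeriesOnBall g p c ⊤ := by
    have := (p.hasFPowerSeriesOnBall (by rw [hrad]; simp)).comp_sub c
    simpa [hrad] using this
  have hga : AnalyticOnNhd ℝ g univ := by
    simpa using hgs.analyticOnNhd
  have hev : f =ᶠ[nhds c] g := by
    obtain ⟨ε, hε⟩ := (hfo c hcm).hasFPowerSeriesAt
    unfold Filter.EventuallyEq Filter.Eventually
    rw [EMetric.mem_nhds_iff]
    exact ⟨ε, hε.r_pos, hε.unique (hgs.mono hε.r_pos le_top)⟩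
  have heq : EqOn f g (Ioo 0 B) := hfo.eqOn_of_preconnected_of_eventuallyEq
    (hga.mono (subset_univ _)) isPreconnected_Ioo hcm hev
  have hgc : ContinuousOn g (Icc 0 B) := hga.continuousOn.mono (subset_univ _)
  -- The identity theorem needs the open interval; continuity adds the end points, and `0` is the
  -- one that matters.
  have heq' : EqOn f g (Icc 0 B) := heq.of_subset_closure hf.continuousOn hgc
    Ioo_subset_Icc_self (by rw [closure_Ioo (by linarith)])
  intro x hx
  rw [heq' hx]
  have := hgs.hasSum_sub (y := x) (by simp)
  simpa [hp, FormalMultilinearSeries.ofScalars_apply_eq, mul_comm] using this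

/-- Uniform Taylor approximation on `[0, B]`, with factorial gain. -/
theorem GevreyBound.exists_polynomial {f : ℝ → ℝ} {B C M : ℝ} (hB : 1 < B) (hC : 0 < C)
    (hM : 0 < M) (hM1 : M < 1) (hf : AnalyticOn ℝ f (Icc 0 B)) (h : GevreyBound f B C M) (m : ℕ) :
    ∃ q : ℝ[X], q.natDegree ≤ m ∧ ∀ x ∈ Icc (0 : ℝ) B,
      |f x - q.eval x| ≤ C * (M * B) ^ (m + 1) / m.factorial * Real.exp B := by
  obtain ⟨b, hb, hs⟩ := h.exists_hasSum hB hf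
  set c := (B + 1) / 2 with hc
  refine ⟨∑ k ∈ Finset.range (m + 1), Polynomial.C (b k) * (X - Polynomial.C c) ^ k, ?_, ?_⟩
  · refine natDegree_sum_le_of_forall_le _ _ fun k hk ↦ ?_
    refine (natDegree_C_mul_le _ _).trans ?_
    rw [natDegree_pow, natDegree_X_sub_C, mul_one]
    exact Nat.lt_succ_iff.mp (Finset.mem_range.mp hk)
  intro x hx
  have hxc : |x - c| ≤ B := abs_le.mpr ⟨by linarith [hx.1], by linarith [hx.2]⟩
  have hq : (∑ k ∈ Finset.range (m + 1),
      Polynomial.C (b k) * (X - Polynomial.C c) ^ k).eval x =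
      ∑ k ∈ Finset.range (m + 1), b k * (x - c) ^ k := by
    simp [eval_finsetSum]
  rw [hq]
  have ht := (hasSum_nat_add_iff' (m + 1)).mpr (hs x hx)
  have he : HasSum (fun k : ℕ ↦ C * (M * B) ^ (m + 1) / m.factorial * (B ^ k / k.factorial))
      (C * (M * B) ^ (m + 1) / m.factorial * Real.exp B) := by
    rw [Real.exp_eq_exp_ℝ]
    exact (NormedSpace.expSeries_div_hasSum_exp B).mul_left _
  rw [← ht.tsum_eq, ← Real.norm_eq_abs]
  refine tsum_of_norm_bounded he fun k ↦ ?_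
  rw [Real.norm_eq_abs, abs_mul, abs_pow]
  -- Splitting the factorial leaves `1 / m!` times the series of `exp B`.
  have hfac : (m.factorial : ℝ) * k.factorial ≤ (k + (m + 1)).factorial := by
    have h1 : k.factorial * m.factorial ≤ (k + m).factorial :=
      Nat.le_of_dvd (Nat.factorial_pos _) (Nat.factorial_mul_factorial_dvd_factorial_add k m)
    have h2 : (k + m).factorial ≤ (k + (m + 1)).factorial := Nat.factorial_le (by omega)
    rw [mul_comm]
    exact_mod_cast h1.trans h2
  have hMk : M ^ (k + (m + 1)) ≤ M ^ (m + 1) := pow_le_pow_of_le_one hM.le hM1.le (by omega)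
  calc |b (k + (m + 1))| * |x - c| ^ (k + (m + 1))
      ≤ C * M ^ (k + (m + 1)) / (k + (m + 1)).factorial * B ^ (k + (m + 1)) := by
        gcongr
        exact hb _
    _ ≤ C * M ^ (m + 1) / (m.factorial * k.factorial) * B ^ (k + (m + 1)) := by
        gcongr
    _ = _ := by
        rw [pow_add B, mul_pow]
        field_simp

/-! ### Chebyshev coefficients and extrapolation to `0` -/

open Polynomial.Chebyshev in
/-- Discrete orthogonality of the Chebyshev polynomials at the Chebyshev nodes. -/
theorem sumZeroes_T_mul_T {n i j : ℕ} (hi : i < n) (hj : j < n) :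
    sumZeroes n (T ℝ i * T ℝ j) =
      if i = j then (if i = 0 then Real.pi else Real.pi / 2) else 0 := by
  have hprod : T ℝ (i : ℤ) * T ℝ (j : ℤ) =
      (1 / 2 : ℝ) • (T ℝ ((i : ℤ) + j) + T ℝ ((i : ℤ) - j)) := by
    rw [← T_mul_T, smul_eq_C_mul, mul_assoc, ← mul_assoc (Polynomial.C _),
      show (2 : ℝ[X]) = Polynomial.C 2 from (map_ofNat Polynomial.C 2).symm, ← Polynomial.C_mul]
    norm_num
  have hadd (P Q : ℝ[X]) : sumZeroes n (P + Q) = sumZeroes n P + sumZeroes n Q := by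
    simp [sumZeroes, Finset.sum_add_distrib, mul_add]
  have hdvd {k : ℤ} (hk : k ≠ 0) (hlt : |k| < 2 * n) : ¬ (2 * n : ℤ) ∣ k := fun h ↦
    hk (Int.eq_zero_of_abs_lt_dvd h hlt)
  rw [hprod, sumZeroes_smul, hadd]
  split_ifs with h1 h2
  · subst h1 h2
    simp only [Nat.cast_zero, add_zero, sub_zero]
    rw [sumZeroes_T_zero (by omega)]
    ring
  · subst h1
    rw [sub_self, sumZeroes_T_zero (by omega),
      sumZeroes_T_of_not_dvd (hdvd (by omega) (by rw [abs_lt]; omega))]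
    ring
  · rw [sumZeroes_T_of_not_dvd (hdvd (by omega) (by rw [abs_lt]; omega)),
      sumZeroes_T_of_not_dvd (hdvd (by omega) (by rw [abs_lt]; omega))]
    ring

open Polynomial.Chebyshev in
/-- A polynomial of degree `m < N` whose mean square over the `N` Chebyshev nodes is at most `S ^ 2`
has Chebyshev coefficients at most `2 * S`. -/
theorem exists_chebyshev_expansion {N m : ℕ} (hmN : m < N) {r : ℝ[X]} (hr : r.natDegree ≤ m)
    {S : ℝ} (hS : 0 ≤ S)
    (h : ∑ i ∈ Finset.range N, r.eval (Real.cos ((2 * i + 1) / (2 * N) * Real.pi)) ^ 2 ≤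
      N * S ^ 2) :
    ∃ a : ℕ → ℝ, r = ∑ j ∈ Finset.range (m + 1), a j • T ℝ j ∧
      ∀ j ∈ Finset.range (m + 1), |a j| ≤ 2 * S := by
  have hmem : r ∈ degreeLT ℝ (m + 1) := by
    rw [mem_degreeLT]
    exact (degree_le_of_natDegree_le hr).trans_lt (by exact_mod_cast Nat.lt_succ_self m)
  rw [← Sequence.span_degreeLT (chebyshevTsequence ℝ) (by simp),
    show Set.Iio (m + 1) = Finset.range (m + 1) by simp,
    Submodule.mem_span_image_finset_iff_exists_fun'] at hmem
  obtain ⟨a, ha⟩ := hmem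
  replace ha : r = ∑ j ∈ Finset.range (m + 1), a j • T ℝ j := ha.symm
  refine ⟨a, ha, fun j hj ↦ ?_⟩
  have hj' := Finset.mem_range.mp hj
  have hcoef : sumZeroes N (r * T ℝ j) = a j * (if j = 0 then Real.pi else Real.pi / 2) := by
    rw [ha, Finset.sum_mul, sumZeroes_sum, Finset.sum_eq_single j]
    · rw [smul_mul_assoc, sumZeroes_smul, sumZeroes_T_mul_T (by omega) (by omega), if_pos rfl]
    · intro i hi hij
      have := Finset.mem_range.mp hi
      rw [smul_mul_assoc, sumZeroes_smul, sumZeroes_T_mul_T (by omega) (by omega), if_neg hij,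
        mul_zero]
    · exact fun h ↦ absurd hj h
  have hN : (0 : ℝ) < N := by exact_mod_cast (by omega : 0 < N)
  have hpi := Real.pi_pos
  have hsum : ∑ i ∈ Finset.range N, |r.eval (Real.cos ((2 * i + 1) / (2 * N) * Real.pi))| ≤
      N * S := by
    refine abs_le_of_sq_le_sq' ?_ (by positivity) |>.2
    calc _ ≤ _ := sq_sum_le_card_mul_sum_sq
      _ ≤ N * (N * S ^ 2) := by
        simp only [sq_abs, Finset.card_range]
        gcongr
      _ = _ := by ring
  have hle : |sumZeroes N (r * T ℝ j)| ≤ Real.pi * S := by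
    rw [sumZeroes, abs_mul, abs_of_pos (by positivity : 0 < Real.pi / N)]
    calc _ ≤ Real.pi / N * (N * S) := by
          gcongr
          refine (Finset.abs_sum_le_sum_abs _ _).trans (le_trans (Finset.sum_le_sum fun i _ ↦ ?_)
            hsum)
          rw [eval_mul, abs_mul]
          exact mul_le_of_le_one_right (abs_nonneg _)
            (abs_eval_T_real_le_one _ (Real.abs_cos_le_one _))
      _ = _ := by field_simp
  -- The smaller weight `π / 2`, for `j ≠ 0`, causes the factor `2`.
  have hw : Real.pi / 2 ≤ (if j = 0 then Real.pi else Real.pi / 2) := by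
    split_ifs <;> linarith
  rw [hcoef, abs_mul, abs_of_pos (by linarith : 0 < (if j = 0 then Real.pi else Real.pi / 2))] at hle
  have := (mul_le_mul_of_nonneg_left hw (abs_nonneg (a j))).trans hle
  nlinarith

theorem one_lt_kappa {B : ℝ} (hB : 1 < B) : 1 < kappa B := by
  have : 1 < Real.sqrt B := by rwa [Real.lt_sqrt zero_le_one, one_pow]
  rw [kappa, one_lt_div (by linarith)]
  linarith

-- The point is `-cosh (log κ)`, since `(κ + κ⁻¹) / 2 = (B + 1) / (B - 1)`, and `T_j (cosh t) = cosh
-- (j t) ≤ exp (j t)` for `t ≥ 0`.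
open Polynomial.Chebyshev in
theorem abs_eval_T_le_kappa_pow {B : ℝ} (hB : 1 < B) (j : ℕ) :
    |(T ℝ j).eval (-((B + 1) / (B - 1)))| ≤ kappa B ^ j := by
  have hk := one_lt_kappa hB
  have hs : 1 < Real.sqrt B := by rwa [Real.lt_sqrt zero_le_one, one_pow]
  have hcosh : (B + 1) / (B - 1) = Real.cosh (Real.log (kappa B)) := by
    rw [Real.cosh_log (by linarith), kappa]
    have h0 : Real.sqrt B - 1 ≠ 0 := by linarith
    have h1 : Real.sqrt B + 1 ≠ 0 := by linarith
    obtain ⟨s, hs'⟩ : ∃ s, s = Real.sqrt B := ⟨_, rfl⟩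
    have hB' : B = s ^ 2 := by rw [hs', Real.sq_sqrt (by linarith)]
    rw [← hs'] at h0 h1 ⊢
    have h2 : s ^ 2 - 1 ≠ 0 := by rw [← hB']; linarith
    rw [hB']
    field_simp
    ring
  rw [T_eval_neg, abs_mul, Int.cast_negOnePow_natCast, abs_pow, abs_neg, abs_one, one_pow, one_mul,
    hcosh, T_real_cosh, abs_of_pos (Real.cosh_pos _)]
  have hl : 0 ≤ (j : ℝ) * Real.log (kappa B) := mul_nonneg (by positivity) (Real.log_nonneg hk.le)
  calc Real.cosh (((j : ℤ) : ℝ) * Real.log (kappa B))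
      ≤ Real.exp (j * Real.log (kappa B)) := by
        rw [Int.cast_natCast, Real.cosh_eq]
        have := Real.exp_le_exp.mpr (by linarith : -((j : ℝ) * Real.log (kappa B)) ≤
          j * Real.log (kappa B))
        linarith
    _ = _ := by rw [Real.exp_nat_mul, Real.exp_log (by linarith)]

open Polynomial.Chebyshev in
/-- Extrapolation: a polynomial of degree `m ≤ n` that is small in mean square at the Chebyshev
nodes on `[1, B]` is at most `O(κ ^ m)` times larger at `0`. -/
theorem abs_eval_zero_le {B : ℝ} (hB : 1 < B) {n m : ℕ} (hmn : m ≤ n) {r : ℝ[X]}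
    (hr : r.natDegree ≤ m) {S : ℝ} (hS : 0 ≤ S)
    (h : ∑ k ∈ Finset.range (n + 1), r.eval (chebNode B n k) ^ 2 ≤ (n + 1) * S ^ 2) :
    |r.eval 0| ≤ 2 * S * (kappa B ^ (m + 1) / (kappa B - 1)) := by
  set L : ℝ[X] := Polynomial.C ((B - 1) / 2) * X + Polynomial.C ((B + 1) / 2) with hL
  have hLe (t : ℝ) : L.eval t = (B - 1) / 2 * t + (B + 1) / 2 := by simp [hL]
  have hdeg : (r.comp L).natDegree ≤ m := by
    rw [natDegree_comp, hL, natDegree_linear (by linarith), mul_one]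
    exact hr
  obtain ⟨a, ha, hab⟩ := exists_chebyshev_expansion (N := n + 1) (by omega) hdeg hS (by
    push_cast
    refine le_of_eq_of_le (Finset.sum_congr rfl fun k _ ↦ ?_) h
    rw [eval_comp, hLe, chebNode]
    congr 5
    ring)
  have h0 : r.eval 0 = ∑ j ∈ Finset.range (m + 1),
      a j * (T ℝ j).eval (-((B + 1) / (B - 1))) := by
    have h1 : (r.comp L).eval (-((B + 1) / (B - 1))) = r.eval 0 := by
      rw [eval_comp, hLe]
      congr 1
      field_simp [(by linarith : B - 1 ≠ 0)]
      ring
    rw [← h1, ha, eval_finsetSum]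
    simp
  have hk := one_lt_kappa hB
  calc |r.eval 0| ≤ ∑ j ∈ Finset.range (m + 1), 2 * S * kappa B ^ j := by
        rw [h0]
        refine (Finset.abs_sum_le_sum_abs _ _).trans (Finset.sum_le_sum fun j hj ↦ ?_)
        rw [abs_mul]
        exact mul_le_mul (hab j hj) (abs_eval_T_le_kappa_pow hB j) (abs_nonneg _) (by positivity)
    _ = 2 * S * ((kappa B ^ (m + 1) - 1) / (kappa B - 1)) := by
        rw [← Finset.mul_sum, geom_sum_eq hk.ne']
    _ ≤ _ := by
        gcongr
        linarith

theorem chebNode_mem_Icc {B : ℝ} (hB : 1 < B) (n k : ℕ) : chebNode B n k ∈ Icc 1 B := by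
  rw [chebNode]
  set t := Real.cos ((2 * (k : ℝ) + 1) * Real.pi / (2 * ((n : ℝ) + 1))) with ht
  have h1 : -1 ≤ t := Real.neg_one_le_cos _
  have h2 : t ≤ 1 := Real.cos_le_one _
  constructor <;> nlinarith

/-! ### Error of the least-squares fit -/

/-- The extrapolation error at `0` of a least-squares fit, in terms of a comparison polynomial. -/
theorem IsLeastSquaresFit.abs_eval_zero_sub_le {f : ℝ → ℝ} {B : ℝ} (hB : 1 < B) {n m : ℕ}
    (hmn : m ≤ n) {p q : ℝ[X]} (hp : IsLeastSquaresFit f B n m p) (hq : q.natDegree ≤ m) {E : ℝ}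
    (hE : 0 ≤ E) (hfq : ∀ x ∈ Icc (0 : ℝ) B, |f x - q.eval x| ≤ E) :
    |p.eval 0 - f 0| ≤ (4 / (kappa B - 1) + 1) * (E * kappa B ^ (m + 1)) := by
  have hk := one_lt_kappa hB
  have hres : sqResidual f B n q ≤ (n + 1) * E ^ 2 := by
    calc sqResidual f B n q ≤ ∑ k ∈ Finset.range (n + 1), E ^ 2 := by
          refine Finset.sum_le_sum fun k _ ↦ ?_
          rw [← sq_abs, abs_sub_comm]
          have := chebNode_mem_Icc hB n k
          gcongr
          exact hfq _ ⟨by linarith [this.1], this.2⟩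
      _ = _ := by simp
  have hsq : ∑ k ∈ Finset.range (n + 1), (p - q).eval (chebNode B n k) ^ 2 ≤
      (n + 1) * (2 * E) ^ 2 := by
    calc _ ≤ 2 * sqResidual f B n p + 2 * sqResidual f B n q := by
          rw [sqResidual, sqResidual, Finset.mul_sum, Finset.mul_sum, ← Finset.sum_add_distrib]
          refine Finset.sum_le_sum fun k _ ↦ ?_
          rw [eval_sub]
          nlinarith [sq_nonneg (p.eval (chebNode B n k) - f (chebNode B n k) +
            (q.eval (chebNode B n k) - f (chebNode B n k)))]
      _ ≤ _ := by linarith [hp.2 q hq]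
  have h1 := abs_eval_zero_le hB hmn ((natDegree_sub_le_of_le hp.1 hq).trans_eq (max_self m)) (by positivity) hsq
  have h2 := hfq 0 ⟨le_rfl, by linarith⟩
  have h3 : E ≤ E * kappa B ^ (m + 1) := le_mul_of_one_le_right hE (one_le_pow₀ hk.le)
  calc |p.eval 0 - f 0| = |(p - q).eval 0 - (f 0 - q.eval 0)| := by rw [eval_sub]; congr 1; ring
    _ ≤ |(p - q).eval 0| + |f 0 - q.eval 0| := abs_sub _ _
    _ ≤ 2 * (2 * E) * (kappa B ^ (m + 1) / (kappa B - 1)) + E * kappa B ^ (m + 1) := by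
        linarith
    _ = _ := by ring

theorem mul_kappa_sq_le {B M μ : ℝ} (hB : 1 < B) (hM : 0 < M) (hM1 : M < 1) (hμ : 0 < μ)
    {n m : ℕ} (hn : 1 ≤ n) (hmn : m ≤ n)
    (h : kappa B ≤ M ^ (-(μ * (m : ℝ) / (2 * (n : ℝ))))) :
    M * kappa B ^ 2 ≤ M ^ (1 - μ) := by
  have hk := one_lt_kappa hB
  have hn' : (0 : ℝ) < n := by exact_mod_cast hn
  have hmn' : (m : ℝ) ≤ n := by exact_mod_cast hmn
  calc M * kappa B ^ 2 ≤ M * (M ^ (-(μ * (m : ℝ) / (2 * (n : ℝ))))) ^ 2 := by gcongr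
    _ = M ^ (1 - μ * (m / n)) := by
        rw [← Real.rpow_mul_natCast hM.le]
        nth_rw 1 [← Real.rpow_one M]
        rw [← Real.rpow_add hM]
        congr 1
        push_cast
        field_simp
        ring
    _ ≤ M ^ (1 - μ) := by
        refine Real.rpow_le_rpow_of_exponent_ge hM hM1.le ?_
        have : (m : ℝ) / n ≤ 1 := by rwa [div_le_one hn']
        nlinarith

/-- Lets `C'` absorb the factor `C * M` of the Taylor error; the term `1 / (1 - M) ≥ 1` alone
suffices. -/
theorem mul_le_biasConst {B C M : ℝ} (hB : 1 < B) (hC : 0 < C) (hM : 0 < M) (hM1 : M < 1)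
    (h : M * kappa B ^ 2 < 1) : 2 * (B - 1) / Real.pi * (C * M) ≤ biasConst B C M := by
  have h1 : 0 ≤ 1 / (1 - M * kappa B ^ 2) := by
    have : 0 < 1 - M * kappa B ^ 2 := by linarith
    positivity
  have h2 : 1 ≤ 1 / (1 - M) := by
    rw [one_le_div (by linarith)]
    linarith
  have h3 : 0 ≤ 2 * (B - 1) * C * M / Real.pi := by
    have : 0 < B - 1 := by linarith
    positivity
  calc 2 * (B - 1) / Real.pi * (C * M) = 2 * (B - 1) * C * M / Real.pi * 1 := by ring
    _ ≤ _ := mul_le_mul_of_nonneg_left (by linarith) h3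

/-- The extrapolation error at `0` decays like `(M κ B) ^ m / m!`, relative to `C'`. -/
theorem exists_abs_eval_zero_sub_le {B : ℝ} (hB : 1 < B) :
    ∃ A : ℝ, 0 < A ∧ ∀ M C : ℝ, 0 < M → M < 1 → 0 < C → M * kappa B ^ 2 < 1 →
      ∀ f : ℝ → ℝ, AnalyticOn ℝ f (Icc (0 : ℝ) B) → GevreyBound f B C M →
      ∀ n m : ℕ, m ≤ n → ∀ p : ℝ[X], IsLeastSquaresFit f B n m p →
        |p.eval 0 - f 0| ≤
          A * biasConst B C M * ((M * kappa B) ^ m * (B ^ m / m.factorial)) := by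
  have hk := one_lt_kappa hB
  have hk' : 0 < kappa B - 1 := by linarith
  have hB' : 0 < B - 1 := by linarith
  have hB0 : 0 < B := by linarith
  refine ⟨(4 / (kappa B - 1) + 1) * (kappa B * B * Real.exp B) / (2 * (B - 1) / Real.pi),
    by positivity, ?_⟩
  intro M C hM hM1 hC hMk f hf hG n m hmn p hp
  obtain ⟨q, hq, hfq⟩ := hG.exists_polynomial hB hC hM hM1 hf m
  have hw : 0 < 2 * (B - 1) / Real.pi := by positivity
  calc |p.eval 0 - f 0|
      ≤ (4 / (kappa B - 1) + 1) *
          (C * (M * B) ^ (m + 1) / m.factorial * Real.exp B * kappa B ^ (m + 1)) :=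
        hp.abs_eval_zero_sub_le hB hmn hq (by positivity) hfq
    _ = (4 / (kappa B - 1) + 1) * (kappa B * B * Real.exp B) / (2 * (B - 1) / Real.pi) *
          (2 * (B - 1) / Real.pi * (C * M)) *
            ((M * kappa B) ^ m * (B ^ m / m.factorial)) := by
        rw [← mul_assoc _ _ (C * M), div_mul_cancel₀ _ hw.ne']
        simp only [mul_pow, pow_succ]
        ring
    _ ≤ _ := by
        have := mul_le_biasConst hB hC hM hM1 hMk
        gcongr

/-! ### Choice of the constants -/

theorem theorem6 (B : ℝ) (hB : 1 < B) :
    -- for every `ε > 0`, with an implied constant that depends only on `B`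
    (∃ K : ℝ, 0 < K ∧
      ∀ M : ℝ, 0 < M → M < 1 →
      ∀ C : ℝ, 0 < C →
      ∀ f : ℝ → ℝ, AnalyticOn ℝ f (Icc (0 : ℝ) B) → GevreyBound f B C M →
      ∀ n m : ℕ, 1 ≤ n → m ≤ n →
      ∀ p : ℝ[X], IsLeastSquaresFit f B n m p →
      ∀ μ : ℝ, 0 < μ → μ < 1 →
        kappa B ≤ M ^ (-(μ * (m : ℝ) / (2 * (n : ℝ)))) →
      ∀ ε : ℝ, 0 < ε →
        K * (max 1 (Real.log (biasConst B C M / ε)) / ((1 - μ) * Real.log (1 / M))) ≤ (m : ℝ) →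
        |p.eval 0 - f 0| < ε) ∧
    -- for every implied constant, however small, as `ε → 0`
    (∀ K : ℝ, 0 < K →
      ∀ M : ℝ, 0 < M → M < 1 →
      ∃ r : ℝ, 0 < r ∧
      ∀ C : ℝ, 0 < C →
      ∀ f : ℝ → ℝ, AnalyticOn ℝ f (Icc (0 : ℝ) B) → GevreyBound f B C M →
      ∀ n m : ℕ, 1 ≤ n → m ≤ n →
      ∀ p : ℝ[X], IsLeastSquaresFit f B n m p →
      ∀ μ : ℝ, 0 < μ → μ < 1 →
        kappa B ≤ M ^ (-(μ * (m : ℝ) / (2 * (n : ℝ)))) →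
      ∀ ε : ℝ, 0 < ε → ε ≤ r * biasConst B C M →
        K * (Real.log (biasConst B C M / ε) / ((1 - μ) * Real.log (1 / M))) ≤ (m : ℝ) →
        |p.eval 0 - f 0| < ε) := by
  obtain ⟨A, hA, hmain⟩ := exists_abs_eval_zero_sub_le hB
  have hk := one_lt_kappa hB
  have hB0 : 0 < B := by linarith
  have hlog {M : ℝ} (hM : 0 < M) (hM1 : M < 1) : 0 < Real.log (1 / M) :=
    Real.log_pos (by rwa [one_lt_div hM])
  have hlt {M μ : ℝ} (hM : 0 < M) (hM1 : M < 1) (hμ1 : μ < 1) : M ^ (1 - μ) < 1 :=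
    Real.rpow_lt_one hM.le hM1 (by linarith)
  have hpos {M C : ℝ} (hM : 0 < M) (hM1 : M < 1) (hC : 0 < C) (h : M * kappa B ^ 2 < 1) :
      0 < biasConst B C M := by
    have : 0 < B - 1 := by linarith
    exact (by positivity : 0 < 2 * (B - 1) / Real.pi * (C * M)).trans_le
      (mul_le_biasConst hB hC hM hM1 h)
  have hMk {M : ℝ} (hM : 0 < M) : M * kappa B ≤ M * kappa B ^ 2 := by
    gcongr
    exact le_self_pow₀ hk.le two_ne_zero
  constructor
  · set D := A * Real.exp B with hD
    have hD0 : 0 < D := by positivity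
    -- `(D + 1) * max 1 L ≥ D + L`: the extra `D` yields a factor `exp (-D)`, which pays for `D = A
    -- * exp B`.
    refine ⟨D + 1, by positivity, ?_⟩
    intro M hM hM1 C hC f hf hG n m hn hmn p hp μ hμ hμ1 hκ ε hε hm
    have hsq := mul_kappa_sq_le hB hM hM1 hμ hn hmn hκ
    have hsq1 := hsq.trans_lt (hlt hM hM1 hμ1)
    have hC' := hpos hM hM1 hC hsq1
    set x := (1 - μ) * Real.log (1 / M) with hx
    have hx0 : 0 < x := mul_pos (by linarith) (hlog hM hM1)
    rw [← mul_div_assoc, div_le_iff₀ hx0] at hm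
    have hxm : D + Real.log (biasConst B C M / ε) ≤ m * x := by
      have h1 := le_max_left 1 (Real.log (biasConst B C M / ε))
      have h2 := le_max_right 1 (Real.log (biasConst B C M / ε))
      nlinarith
    have hpow : (M * kappa B) ^ m ≤ Real.exp (-D) * (ε / biasConst B C M) := by
      calc (M * kappa B) ^ m ≤ (M ^ (1 - μ)) ^ m := by
            gcongr
            exact (hMk hM).trans hsq
        _ = Real.exp (-(m * x)) := by
            rw [Real.rpow_def_of_pos hM, ← Real.exp_nat_mul, hx, one_div, Real.log_inv]
            congr 1
            ring
        _ ≤ Real.exp (-D + -Real.log (biasConst B C M / ε)) := by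
            gcongr
            linarith
        _ = _ := by
            rw [Real.exp_add, ← Real.log_inv, inv_div, Real.exp_log (by positivity)]
    have hDexp : D * Real.exp (-D) < 1 := by
      rw [Real.exp_neg, ← div_eq_mul_inv, div_lt_one (Real.exp_pos _)]
      linarith [Real.add_one_le_exp D]
    calc |p.eval 0 - f 0|
        ≤ A * biasConst B C M * ((M * kappa B) ^ m * (B ^ m / m.factorial)) :=
          hmain M C hM hM1 hC hsq1 f hf hG n m hmn p hp
      _ ≤ A * biasConst B C M * (Real.exp (-D) * (ε / biasConst B C M) * Real.exp B) := by
          gcongr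
          exact Real.pow_div_factorial_le_exp B hB0.le m
      _ = D * Real.exp (-D) * ε := by
          rw [hD]
          field_simp
      _ < ε := mul_lt_of_lt_one_left hε hDexp
  · intro K hK M hM hM1
    have hl := hlog hM hM1
    -- As `1 - μ ≤ 1`, the condition on `m` gives `C' * exp (-(m * y)) ≤ ε`, so `A * (B * exp y) ^ m
    -- / m! < 1` is enough.
    set y := Real.log (1 / M) / K with hy
    have hy0 : 0 < y := by positivity
    have hev := ((FloorSemiring.tendsto_pow_div_factorial_atTop
      (B * Real.exp y)).const_mul A).eventually_lt_const
      (by simp : A * 0 < 1)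
    obtain ⟨m₀, hm₀⟩ := Filter.eventually_atTop.mp hev
    -- This `r` forces `m₀ * y ≤ log (C' / ε) ≤ m * y`, hence `m₀ ≤ m`.
    refine ⟨Real.exp (-(m₀ * y)), Real.exp_pos _, ?_⟩
    intro C hC f hf hG n m hn hmn p hp μ hμ hμ1 hκ ε hε hεr hm
    have hsq := mul_kappa_sq_le hB hM hM1 hμ hn hmn hκ
    have hsq1 := hsq.trans_lt (hlt hM hM1 hμ1)
    have hC' := hpos hM hM1 hC hsq1
    have hx0 : 0 < (1 - μ) * Real.log (1 / M) := mul_pos (by linarith) hl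
    rw [← mul_div_assoc, div_le_iff₀ hx0] at hm
    have hlogε : m₀ * y ≤ Real.log (biasConst B C M / ε) := by
      rw [Real.le_log_iff_exp_le (by positivity), le_div_iff₀ hε]
      calc _ ≤ Real.exp (m₀ * y) * (Real.exp (-(m₀ * y)) * biasConst B C M) := by gcongr
        _ = _ := by rw [← mul_assoc, ← Real.exp_add]; simp
    have hmy : Real.log (biasConst B C M / ε) ≤ m * y := by
      rw [hy, ← mul_div_assoc, le_div_iff₀ hK]
      have : (m : ℝ) * ((1 - μ) * Real.log (1 / M)) ≤ m * Real.log (1 / M) := by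
        gcongr
        exact mul_le_of_le_one_left hl.le (by linarith)
      linarith
    have hmm : m₀ ≤ m := by
      exact_mod_cast le_of_mul_le_mul_right (hlogε.trans hmy) hy0
    have hfin := hm₀ m hmm
    have hε' : biasConst B C M * Real.exp (-(m * y)) ≤ ε := by
      rw [Real.exp_neg, ← div_eq_mul_inv, div_le_iff₀ (Real.exp_pos _), mul_comm,
        ← div_le_iff₀ hε]
      exact (Real.log_le_iff_le_exp (by positivity)).mp hmy
    calc |p.eval 0 - f 0|
        ≤ A * biasConst B C M * ((M * kappa B) ^ m * (B ^ m / m.factorial)) :=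
          hmain M C hM hM1 hC hsq1 f hf hG n m hmn p hp
      _ ≤ A * biasConst B C M * (1 * (B ^ m / m.factorial)) := by
          gcongr
          exact pow_le_one₀ (by positivity) ((hMk hM).trans hsq1.le)
      _ = A * ((B * Real.exp y) ^ m / m.factorial) *
            (biasConst B C M * Real.exp (-(m * y))) := by
          rw [mul_pow, ← Real.exp_nat_mul, Real.exp_neg]
          field_simp
      _ < 1 * (biasConst B C M * Real.exp (-(m * y))) := by gcongr
      _ ≤ ε := by rwa [one_mul]
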